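/- Let $V$ be a finite-dimensional real inner product space, $\gamma,\sigma:[\alpha,\beta]\to V$ continuous paths of bounded variation, and $s,t\in[\alpha,\beta]$. For a continuous path $\gamma$ of bounded variation let $S(\gamma)_{\alpha,s}^k=\int_{\alpha<u_1<\dots<u_k<s}d\gamma_{u_1}\otimes\cdots\otimes d\gamma_{u_k}\in V^{\otimes k}$ (with $S(\gamma)^0_{\alpha,s}=1$) be the $k$-th level of its signature, let $\langle\cdot,\cdot\rangle_k$ be the Hilbert–Schmidt inner product on $V^{\otimes k}$, let $$K^{\gamma,\sigma}(s,t)=\sum_{k=0}^\infty\langle S(\gamma)_{\alpha,s}^k,S(\sigma)_{\alpha,t}^k\rangle_k$$ be the signature kernel, and let $L_s(\gamma)$ be the length of $\gamma|_{[\alpha,s]}$. For $x\in\mathbb R$ let $x\gamma$ be the path $u\mapsto x\,\gamma_u$. Let $a<b$ be real numbers, let $w:(a,b)\to(0,\infty)$ be continuous with $w\in L^1(a,b)$, and let $(p_n)_{n\ge 0}$ be real polynomials with $\deg p_n=n$ and $\int_a^b p_mp_nw\,dx=0$ for $m\ne n$. Let $n\ge 0$, let $x_0,\dots,x_n$ be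 the zeros of $p_{n+1}$, and put $$w_k=\int_a^b w(x)\prod_{i\ne k}\Big(\frac{x-x_i}{x_k-x_i}\Big)^2dx,\qquad \pi_{n+1}(x)=\prod_{i=0}^n(x-x_i).$$ Then all these objects are well defined: the series for $K^{x\gamma,\sigma}(s,t)$ is summable for every $x\in\mathbb R$, the function $x\mapsto K^{x\gamma,\sigma}(s,t)\,w(x)$ is integrable on $(a,b)$, and $p_{n+1}$ has exactly $n+1$ distinct real zeros. Moreover there is a $\xi\in(a,b)$ such that $$\left|\int_a^bK^{x\gamma,\sigma}(s,t)\,w(x)\,dx-\sum_{k=0}^nw_kK^{x_k\gamma,\sigma}(s,t)\right|\le\frac{L_s(\gamma)^{2n+2}L_t(\sigma)^{2n+2}\exp\big(|\xi|L_s(\gamma)L_t(\sigma)\big)}{[(2n+2)!]^2}\int_a^bw(x)\,\pi_{n+1}(x)^2\,dx .$$ -/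

import Mathlib

open MeasureTheory

noncomputable section

/-- A continuous path `[α, β] → V` of bounded variation. -/
structure BVPath (α β : ℝ) (V : Type*) [NormedAddCommGroup V] where
  toFun : Set.Icc α β → V
  continuous_toFun : Continuous toFun
  boundedVariation : BoundedVariationOn toFun Set.univ

namespace BVPath

variable {α β : ℝ} {V : Type*} [NormedAddCommGroup V] [InnerProductSpace ℝ V]

/-- The rescaled path `x γ`, that is `u ↦ x • γ u`. -/
def scale (x : ℝ) (γ : BVPath α β V) : BVPath α β V where
  toFun u := x • γ.toFun u
  continuous_toFun := γ.continuous_toFun.const_smul x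
  boundedVariation :=
    (lipschitzWith_smul x).lipschitzOnWith.comp_boundedVariationOn
      (Set.mapsTo_univ γ.toFun Set.univ) γ.boundedVariation

/-- `L_s(γ)`: the length (total variation in the norm of `V`) of the path segment `γ|_[α,s]`. -/
def length (γ : BVPath α β V) (s : Set.Icc α β) : ℝ :=
  (eVariationOn γ.toFun (Set.Iic s)).toReal

variable [FiniteDimensional ℝ V]

/-- The `V`-valued Stieltjes measure `dγ` on `[α, β]`. -/
def stieltjes (γ : BVPath α β V) : VectorMeasure (Set.Icc α β) V :=
  haveI : CompleteSpace V := FiniteDimensional.complete ℝ V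
  haveI : CompactIccSpace (Set.Icc α β) := ⟨fun {_ _} => isClosed_Icc.isCompact⟩
  γ.boundedVariation.vectorMeasure

/-- The coefficient `S(γ)_{α,t}(v₁ ⋯ v_k)` of the signature along linear functionals
`v₁, …, v_k` on `V`, by the recursion `S(γ)_{α,t}(1) = 1` and
`S(γ)_{α,t}(v₁ ⋯ v_{k+1}) = ∫_α^t S(γ)_{α,u}(v₁ ⋯ v_k) d v_{k+1}(γ_u)`.
The pairing `toSpanSingleton ℝ v` is `(c, y) ↦ c * v y`, so the integral is the Stieltjes integral
of `S(γ)_{α,u}(v₁ ⋯ v_k)` against `d v_{k+1}(γ_u) = v_{k+1}(dγ_u)` over `[α, t]`. -/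
def sigCoeff (γ : BVPath α β V) : (k : ℕ) → (Fin k → StrongDual ℝ V) → Set.Icc α β → ℝ
  | 0, _, _ => 1
  | k + 1, v, t =>
      ∫ᵛ u in Set.Iic t, sigCoeff γ k (fun i => v i.castSucc) u
        ∂[ContinuousLinearMap.toSpanSingleton ℝ (v (Fin.last k)); γ.stieltjes]

variable {ι : Type*} [Fintype ι]

/-- `⟨S(γ)_{α,s}^k, S(σ)_{α,t}^k⟩_k`: the Hilbert–Schmidt inner product on `V^{⊗k}` of the levels
`k` of the two signatures, as the sum over all words `I = (i₁, …, i_k)` in the orthonormal basis `e`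
of the products of the coefficients along the dual words `e_I^*`. -/
def sigInner (e : OrthonormalBasis ι ℝ V) (γ σ : BVPath α β V) (s t : Set.Icc α β) (k : ℕ) : ℝ :=
  ∑ I : Fin k → ι, γ.sigCoeff k (fun j => innerSL ℝ (e (I j))) s *
    σ.sigCoeff k (fun j => innerSL ℝ (e (I j))) t

/-- The original signature kernel
`K^{γ,σ}(s,t) = ∑_k ⟨S(γ)_{α,s}^k, S(σ)_{α,t}^k⟩_k`. -/
def sigKernel (e : OrthonormalBasis ι ℝ V) (γ σ : BVPath α β V) (s t : Set.Icc α β) : ℝ :=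
  ∑' k : ℕ, sigInner e γ σ s t k

end BVPath

namespace GaussQuadrature

open Polynomial

/-- `p` is a system of orthogonal polynomials with respect to the weight `w` over `(a, b)`:
`deg p_n = n` and `∫_a^b p_m p_n w dx = 0` for `m ≠ n`. -/
structure IsOrthogonalSystem (a b : ℝ) (w : ℝ → ℝ) (p : ℕ → ℝ[X]) : Prop where
  degree_eq : ∀ n : ℕ, (p n).degree = n
  orthogonal : ∀ m n : ℕ, m ≠ n →
    ∫ x in Set.Ioo a b, (p m).eval x * (p n).eval x * w x = 0

/-- The nodes of the `(n+1)`-point rule: the real zeros of `p_{n+1}`. -/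
def nodes (p : ℕ → ℝ[X]) (n : ℕ) : Finset ℝ :=
  (p (n + 1)).roots.toFinset

/-- The quadrature weight at the node `c`, that is
`∫_a^b w(x) ∏_{c' ≠ c} ((x - c') / (c - c'))² dx`, with `c'` running over the other nodes. -/
def weight (a b : ℝ) (w : ℝ → ℝ) (p : ℕ → ℝ[X]) (n : ℕ) (c : ℝ) : ℝ :=
  ∫ x in Set.Ioo a b, w x * ∏ c' ∈ (nodes p n).erase c, ((x - c') / (c - c')) ^ 2

/-- The monic node polynomial `π_{n+1}(x) = ∏ (x - c)`, the product over all nodes `c`. -/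
def nodePoly (p : ℕ → ℝ[X]) (n : ℕ) (x : ℝ) : ℝ :=
  ∏ c ∈ nodes p n, (x - c)

end GaussQuadrature

end

/-!
By homogeneity `K^{xγ,σ}(s,t) = ∑ x ^ k * A_k` with `A_k = ⟨S(γ)_{α,s}^k, S(σ)_{α,t}^k⟩`. As `|dγ|`
is dominated by the arc-length measure, `‖S(γ)_{α,s}^k‖ ≤ L_s(γ) ^ k / k!`, and likewise for `σ`,
so `|A_k| ≤ (L_s(γ) L_t(σ)) ^ k / (k!) ^ 2`.

The Gauss rule with nodal polynomial `π` of degree `n + 1` is exact in degree `< m := 2 n + 2`, so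
its error on `x ^ k` is `∫ w π² q_k`, where `q_k` is the quotient of the division of `x ^ k` by
`π²`. With `M = max |a| |b|`, peeling off one linear factor of `π²` at a time gives
`|q_k| ≤ C(k, m) M ^ (k - m)` on `(a, b)`. Against the coefficient bound at `k = j + m`, the
factorials leave `1 / ((m!)² j! 2 ^ j)`, so the errors sum to an exponential of
`(M / 2) L_s(γ) L_t(σ)`, and any `ξ` in `(a, b)` with `M / 2 ≤ |ξ|` will do.
-/

noncomputable section

open Set Filter Topology

section ContinuousStieltjes

variable {R : Type*} [LinearOrder R] [TopologicalSpace R] [OrderTopology R] [CompactIccSpace R]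
  {f : StieltjesFunction R}

lemma exists_preimage_Iic_inter_Icc_eq [PreconnectedSpace R] (hf : Continuous f) {a b : R}
    (hab : a ≤ b) {y : ℝ} (hy : f a ≤ y) :
    ∃ u, f u = min y (f b) ∧ f ⁻¹' Iic y ∩ Icc a b = Icc a u := by
  have hay : f a ≤ min y (f b) := le_min hy (f.mono hab)
  obtain ⟨v, hv⟩ : min y (f b) ∈ range f :=
    mem_range_of_exists_le_of_exists_ge hf ⟨a, hay⟩ ⟨b, min_le_right _ _⟩
  have hcompact : IsCompact (Icc a b ∩ f ⁻¹' {min y (f b)}) :=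
    isCompact_Icc.inter_right (isClosed_singleton.preimage hf)
  have hne : (Icc a b ∩ f ⁻¹' {min y (f b)}).Nonempty := by
    refine ⟨max a (min v b), ⟨le_max_left _ _, max_le hab (min_le_right _ _)⟩, ?_⟩
    simp only [mem_preimage, mem_singleton_iff, f.mono.map_max, f.mono.map_min, hv]
    rw [min_assoc, min_self, max_eq_right hay]
  obtain ⟨u, ⟨⟨-, hub⟩, hfu⟩, hu⟩ := hcompact.exists_isGreatest hne
  refine ⟨u, hfu, Subset.antisymm ?_ ?_⟩
  · rintro x ⟨hxy, hax, hxb⟩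
    refine ⟨hax, le_of_not_gt fun hux => hux.not_ge (hu ⟨⟨hax, hxb⟩, ?_⟩)⟩
    exact le_antisymm (le_min hxy (f.mono hxb)) (hfu.symm.trans_le (f.mono hux.le))
  · exact fun x hx => ⟨(f.mono hx.2).trans (hfu.trans_le (min_le_left _ _)), hx.1, hx.2.trans hub⟩

variable [DenselyOrdered R] [SecondCountableTopology R] [MeasurableSpace R] [BorelSpace R]

lemma stieltjes_measure_Icc_of_continuous (hf : Continuous f) (a b : R) :
    f.measure (Icc a b) = ENNReal.ofReal (f b - f a) := by
  rw [f.measure_Icc, hf.continuousWithinAt.leftLim_eq]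

lemma map_restrict_stieltjes_measure [PreconnectedSpace R] (hf : Continuous f) {a b : R}
    (hab : a ≤ b) :
    (f.measure.restrict (Icc a b)).map f = volume.restrict (Icc (f a) (f b)) := by
  have : IsFiniteMeasure (f.measure.restrict (Icc a b)) :=
    ⟨by simp [stieltjes_measure_Icc_of_continuous hf]⟩
  refine Measure.ext_of_Iic _ _ fun y => ?_
  rw [Measure.map_apply hf.measurable measurableSet_Iic,
    Measure.restrict_apply (hf.measurable measurableSet_Iic),
    Measure.restrict_apply measurableSet_Iic, inter_comm (Iic y), ← Ici_inter_Iic (a := f a),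
    inter_assoc, Iic_inter_Iic, Ici_inter_Iic, Real.volume_Icc]
  rcases lt_or_ge y (f a) with hy | hy
  · have hempty : f ⁻¹' Iic y ∩ Icc a b = ∅ :=
      eq_empty_of_forall_notMem fun u hu => (hy.trans_le (f.mono hu.2.1)).not_ge hu.1
    rw [hempty, measure_empty, ENNReal.ofReal_of_nonpos]
    linarith [min_le_right (f b) y]
  · obtain ⟨u, hu, hset⟩ := exists_preimage_Iic_inter_Icc_eq hf hab hy
    rw [hset, stieltjes_measure_Icc_of_continuous hf, hu, min_comm]

lemma setIntegral_pow_stieltjes_measure [PreconnectedSpace R] (hf : Continuous f) {a b : R}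
    (hab : a ≤ b) (k : ℕ) :
    ∫ u in Icc a b, f u ^ k ∂f.measure = (f b ^ (k + 1) - f a ^ (k + 1)) / (k + 1) := by
  rw [← integral_map hf.measurable.aemeasurable (f := fun y : ℝ => y ^ k) (by fun_prop),
    map_restrict_stieltjes_measure hf hab, integral_Icc_eq_integral_Ioc,
    ← intervalIntegral.integral_of_le (f.mono hab), integral_pow]

end ContinuousStieltjes

namespace BVPath

variable {α β : ℝ} {V : Type*} [NormedAddCommGroup V]

instance : CompactIccSpace (Icc α β) := ⟨fun {_ _} => isClosed_Icc.isCompact⟩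

section ArcLength

/-- The left endpoint of `[α, β]`, given any point of the interval. -/
def start (t : Icc α β) : Icc α β := ⟨α, le_rfl, t.2.1.trans t.2.2⟩

lemma start_le (t u : Icc α β) : start t ≤ u := u.2.1

lemma Iic_eq_Icc_start (t : Icc α β) : Iic t = Icc (start t) t := by
  ext u
  simp [start_le]

lemma length_eq_variationOnFromTo (γ : BVPath α β V) (t u : Icc α β) :
    γ.length u = variationOnFromTo γ.toFun univ (start t) u := by
  rw [variationOnFromTo.eq_of_le _ _ (start_le t u), univ_inter]
  rw [show Icc (start t) u = Iic u from (Iic_eq_Icc_start u).symm, length]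

lemma length_sub (γ : BVPath α β V) (u v : Icc α β) :
    γ.length v - γ.length u = variationOnFromTo γ.toFun univ u v := by
  rw [γ.length_eq_variationOnFromTo u v, γ.length_eq_variationOnFromTo u u,
    variationOnFromTo.sub_right γ.boundedVariation.locallyBoundedVariationOn
      (mem_univ _) (mem_univ _) (mem_univ _)]

lemma length_nonneg (γ : BVPath α β V) (t : Icc α β) : 0 ≤ γ.length t :=
  ENNReal.toReal_nonneg

lemma length_start (γ : BVPath α β V) (t : Icc α β) : γ.length (start t) = 0 := by
  rw [γ.length_eq_variationOnFromTo t, variationOnFromTo.self]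

lemma monotone_length (γ : BVPath α β V) : Monotone γ.length := fun u v huv => by
  rw [← sub_nonneg, length_sub]
  exact variationOnFromTo.nonneg_of_le _ _ huv

lemma norm_sub_le_length_sub (γ : BVPath α β V) {u v : Icc α β} (huv : u ≤ v) :
    ‖γ.toFun v - γ.toFun u‖ ≤ γ.length v - γ.length u := by
  rw [length_sub, ← dist_eq_norm', variationOnFromTo.eq_of_le _ _ huv, dist_edist]
  refine ENNReal.toReal_mono ?_ (eVariationOn.edist_le _ ?_ ?_)
  · exact ((eVariationOn.mono _ (subset_univ _)).trans_lt γ.boundedVariation.lt_top).ne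
  · exact ⟨mem_univ _, le_rfl, huv⟩
  · exact ⟨mem_univ _, huv, le_rfl⟩

lemma continuous_length (γ : BVPath α β V) : Continuous γ.length := by
  refine continuous_iff_continuousAt.2 fun x =>
    continuousAt_iff_continuous_left_right.2 ⟨?_, ?_⟩
  · have hzero : Tendsto (fun y => (eVariationOn γ.toFun (univ ∩ Icc y x)).toReal) (𝓝 x) (𝓝 0) := by
      simpa only [nhdsWithin_univ, ENNReal.toReal_zero, Function.comp_def] using
        (ENNReal.tendsto_toReal ENNReal.zero_ne_top).comp
        (γ.boundedVariation.tendsto_eVariationOn_Icc_zero_left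
          γ.continuous_toFun.continuousWithinAt)
    have hsub := (tendsto_const_nhds (x := γ.length x)).sub
      (hzero.mono_left (nhdsWithin_le_nhds (s := Iic x)))
    rw [sub_zero] at hsub
    refine hsub.congr' ?_
    filter_upwards [self_mem_nhdsWithin] with y hy
    rw [← variationOnFromTo.eq_of_le _ _ hy, ← length_sub, sub_sub_cancel]
  · rw [funext (γ.length_eq_variationOnFromTo x)]
    exact γ.boundedVariation.continuousWithinAt_variationOnFromTo_Ici
      γ.continuous_toFun.continuousWithinAt

/-- The length of a path as a Stieltjes function of its endpoint. -/
def lengthStieltjes (γ : BVPath α β V) : StieltjesFunction (Icc α β) where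
  toFun := γ.length
  mono' := γ.monotone_length
  right_continuous' _ := γ.continuous_length.continuousWithinAt

/-- The arc-length measure of a path. -/
def lengthMeasure (γ : BVPath α β V) : Measure (Icc α β) := γ.lengthStieltjes.measure

instance (γ : BVPath α β V) : IsFiniteMeasure γ.lengthMeasure :=
  StieltjesFunction.isFiniteMeasure_of_forall_abs_le (C := (eVariationOn γ.toFun univ).toReal) _
    fun x => (abs_of_nonneg (γ.length_nonneg x)).trans_le
      (ENNReal.toReal_mono γ.boundedVariation (eVariationOn.mono _ (subset_univ _)))

lemma lengthMeasure_singleton (γ : BVPath α β V) (u : Icc α β) : γ.lengthMeasure {u} = 0 := by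
  rw [lengthMeasure, ← Icc_self,
    stieltjes_measure_Icc_of_continuous (f := γ.lengthStieltjes) γ.continuous_length, sub_self,
    ENNReal.ofReal_zero]

lemma setIntegral_length_pow (γ : BVPath α β V) (t : Icc α β) (k : ℕ) :
    ∫ u in Iic t, γ.length u ^ k ∂γ.lengthMeasure = γ.length t ^ (k + 1) / (k + 1) := by
  have : PreconnectedSpace (Icc α β) := Subtype.preconnectedSpace isPreconnected_Icc
  have h := setIntegral_pow_stieltjes_measure (f := γ.lengthStieltjes) γ.continuous_length
    (start_le t t) k
  rw [Iic_eq_Icc_start]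
  refine h.trans ?_
  change (γ.length t ^ (k + 1) - γ.length (start t) ^ (k + 1)) / _ = _
  rw [length_start, zero_pow k.succ_ne_zero, sub_zero]

end ArcLength

variable [InnerProductSpace ℝ V] [FiniteDimensional ℝ V]

section Stieltjes

lemma stieltjes_Iic (γ : BVPath α β V) (t : Icc α β) :
    γ.stieltjes (Iic t) = γ.toFun t - γ.toFun (start t) := by
  have : CompleteSpace V := FiniteDimensional.complete ℝ V
  rw [Iic_eq_Icc_start, stieltjes, BoundedVariationOn.vectorMeasure_Icc _ (start_le t t),
    γ.continuous_toFun.continuousWithinAt.rightLim_eq,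
    γ.continuous_toFun.continuousWithinAt.leftLim_eq]

lemma eq_stieltjes_of_forall_Iic (γ : BVPath α β V) {m : VectorMeasure (Icc α β) V}
    (h : ∀ t, m (Iic t) = γ.toFun t - γ.toFun (start t)) : m = γ.stieltjes := by
  have heq : ∀ t, m (Iic t) = γ.stieltjes (Iic t) := fun t => by rw [h, stieltjes_Iic]
  refine VectorMeasure.ext_of_generateFrom (range Iic) (forall_mem_range.2 heq) ?_
    isPiSystem_Iic ?_
  · rw [← borel_eq_generateFrom_Iic]
    exact BorelSpace.measurable_eq
  · rcases isEmpty_or_nonempty (Icc α β) with hempty | ⟨⟨t⟩⟩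
    · simp [univ_eq_empty_iff.2 hempty]
    · have huniv : (univ : Set (Icc α β)) = Iic ⟨β, t.2.1.trans t.2.2, le_rfl⟩ :=
        eq_univ_of_forall (fun v => v.2.2) |>.symm
      rw [huniv, heq]

lemma measurableSpace_eq_generateFrom_Ioc :
    (inferInstance : MeasurableSpace (Icc α β)) =
      MeasurableSpace.generateFrom {s | ∃ u v : Icc α β, u ≤ v ∧ s = Ioc u v} := by
  refine (BorelSpace.measurable_eq.trans (borel_eq_generateFrom_Ioc_le (Icc α β))).trans ?_
  congr 1
  ext s
  simp only [mem_ofPred_eq]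
  grind

lemma enorm_stieltjes_le (γ : BVPath α β V) (s : Set (Icc α β)) :
    ‖γ.stieltjes s‖ₑ ≤ γ.lengthMeasure s := by
  have : CompleteSpace V := FiniteDimensional.complete ℝ V
  rcases isEmpty_or_nonempty (Icc α β) with hempty | _
  · simp [eq_empty_of_isEmpty s]
  have hincrement : ∀ r ∈ {s | ∃ u v : Icc α β, u ≤ v ∧ s = Ioc u v},
      ‖AddContent.onIoc γ.toFun r‖ₑ ≤ γ.lengthMeasure r := by
    rintro _ ⟨u, v, huv, rfl⟩
    rw [AddContent.onIoc_apply huv, lengthMeasure, StieltjesFunction.measure_Ioc, ← ofReal_norm]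
    exact ENNReal.ofReal_le_ofReal (γ.norm_sub_le_length_sub huv)
  obtain ⟨m, hm_Ioc, hm_le⟩ :=
    VectorMeasure.exists_extension_of_isSetSemiring_of_le_measure_of_generateFrom
      IsSetSemiring.Ioc hincrement measurableSpace_eq_generateFrom_Ioc
  have hm_singleton (t : Icc α β) : m {t} = 0 := by
    rw [← enorm_eq_zero, ← nonpos_iff_eq_zero]
    exact (hm_le _).trans (γ.lengthMeasure_singleton _).le
  rw [← γ.eq_stieltjes_of_forall_Iic (m := m) fun t => ?_]
  · exact hm_le s
  rw [Iic_eq_Icc_start, ← Icc_union_Ioc_eq_Icc le_rfl (start_le t t),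
    VectorMeasure.of_union (by simp) measurableSet_Icc measurableSet_Ioc, Icc_self, hm_singleton,
    hm_Ioc _ ⟨_, _, start_le t t, rfl⟩, AddContent.onIoc_apply (start_le t t), zero_add]

lemma variation_stieltjes_le (γ : BVPath α β V) : γ.stieltjes.variation ≤ γ.lengthMeasure :=
  VectorMeasure.variation_le_of_forall_enorm_le fun s _ => γ.enorm_stieltjes_le s

instance (γ : BVPath α β V) : IsFiniteMeasure γ.stieltjes.variation :=
  isFiniteMeasure_of_le _ γ.variation_stieltjes_le

lemma stieltjes_scale (x : ℝ) (γ : BVPath α β V) : (γ.scale x).stieltjes = x • γ.stieltjes := by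
  refine ((γ.scale x).eq_stieltjes_of_forall_Iic fun t => ?_).symm
  rw [_root_.smul_apply, stieltjes_Iic, smul_sub]
  rfl

lemma integrable_of_continuous {μ : Measure (Icc α β)} [IsFiniteMeasure μ] {E : Type*}
    [NormedAddCommGroup E] {f : Icc α β → E} (hf : Continuous f) : Integrable f μ := by
  simpa only [integrableOn_univ] using hf.continuousOn.integrableOn_compact (μ := μ) isCompact_univ

variable {E G : Type*} [NormedAddCommGroup E] [NormedSpace ℝ E] [NormedAddCommGroup G]
  [NormedSpace ℝ G]

lemma continuous_setIntegral_Iic (γ : BVPath α β V) (B : E →L[ℝ] V →L[ℝ] G) {f : Icc α β → E}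
    (hf : Continuous f) : Continuous fun t => ∫ᵛ u in Iic t, f u ∂[B; γ.stieltjes] := by
  simp_rw [← VectorMeasure.integral_indicator measurableSet_Iic]
  refine continuous_iff_continuousAt.2 fun t =>
    VectorMeasure.continuousAt_of_dominated (bound := fun u => ‖f u‖) ?_ ?_ ?_ ?_
  · exact Eventually.of_forall fun s =>
      (integrable_of_continuous hf).aestronglyMeasurable.indicator measurableSet_Iic
  · exact Eventually.of_forall fun s => Eventually.of_forall fun u =>
      norm_indicator_le_norm_self _ _
  · exact (integrable_of_continuous hf).norm
  · have hne : ∀ᵐ u ∂γ.stieltjes.variation, u ≠ t := by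
      refine compl_mem_ae_iff.2 (nonpos_iff_eq_zero.1 ?_)
      exact (γ.variation_stieltjes_le _).trans (γ.lengthMeasure_singleton t).le
    filter_upwards [hne] with u hu
    refine (continuousAt_const (y := (Iic t).indicator f u)).congr ?_
    rcases hu.lt_or_gt with h | h
    · filter_upwards [Ioi_mem_nhds h] with s hs
      rw [indicator_of_mem (mem_Iic.2 h.le), indicator_of_mem (mem_Iic.2 (le_of_lt hs))]
    · filter_upwards [Iio_mem_nhds h] with s hs
      rw [indicator_of_notMem (by simpa using h), indicator_of_notMem (by simpa using hs)]

lemma norm_setIntegral_stieltjes_le (γ : BVPath α β V) {B : E →L[ℝ] V →L[ℝ] G} (hB : ‖B‖ ≤ 1)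
    {f : Icc α β → E} (hf : Continuous f) (t : Icc α β) :
    ‖∫ᵛ u in Iic t, f u ∂[B; γ.stieltjes]‖ ≤ ∫ u in Iic t, ‖f u‖ ∂γ.lengthMeasure := by
  calc ‖∫ᵛ u in Iic t, f u ∂[B; γ.stieltjes]‖
      ≤ ‖B‖ * ∫ u, ‖f u‖ ∂(γ.stieltjes.restrict (Iic t)).variation :=
        VectorMeasure.norm_integral_le_integral_norm
    _ ≤ ∫ u, ‖f u‖ ∂(γ.stieltjes.restrict (Iic t)).variation :=
        mul_le_of_le_one_left (integral_nonneg fun _ => norm_nonneg _) hB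
    _ ≤ ∫ u in Iic t, ‖f u‖ ∂γ.lengthMeasure := by
        rw [VectorMeasure.variation_restrict measurableSet_Iic]
        exact integral_mono_measure (Measure.restrict_mono le_rfl γ.variation_stieltjes_le)
          (Eventually.of_forall fun _ => norm_nonneg _) (integrable_of_continuous hf).norm

end Stieltjes

section Signature

variable {ι : Type*} [Fintype ι]

lemma continuous_sigCoeff (γ : BVPath α β V) (k : ℕ) (v : Fin k → StrongDual ℝ V) :
    Continuous (γ.sigCoeff k v) := by
  induction k with
  | zero => exact continuous_const
  | succ k ih => exact γ.continuous_setIntegral_Iic _ (ih _)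

lemma sigCoeff_scale (x : ℝ) (γ : BVPath α β V) (k : ℕ) (v : Fin k → StrongDual ℝ V)
    (t : Icc α β) : (γ.scale x).sigCoeff k v t = x ^ k * γ.sigCoeff k v t := by
  induction k generalizing t with
  | zero => simp [sigCoeff]
  | succ k ih =>
    simp only [sigCoeff, stieltjes_scale, ih, VectorMeasure.restrict_smul,
      VectorMeasure.integral_smul_vectorMeasure, ← smul_eq_mul (a := x ^ k),
      VectorMeasure.integral_fun_smul]
    rw [smul_smul, smul_eq_mul, pow_succ]

lemma sigInner_scale (e : OrthonormalBasis ι ℝ V) (x : ℝ) (γ σ : BVPath α β V)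
    (s t : Icc α β) (k : ℕ) : sigInner e (γ.scale x) σ s t k = x ^ k * sigInner e γ σ s t k := by
  simp only [sigInner, sigCoeff_scale, Finset.mul_sum, mul_assoc]

omit [FiniteDimensional ℝ V] in
lemma sum_sq_mul_inner (e : OrthonormalBasis ι ℝ V) {k : ℕ} (x : EuclideanSpace ℝ (Fin k → ι))
    (v : V) :
    ∑ I : Fin (k + 1) → ι, (x (Fin.init I) * inner ℝ (e (I (Fin.last k))) v) ^ 2 =
      (‖x‖ * ‖v‖) ^ 2 := by
  rw [← (Fin.snocEquiv fun _ => ι).sum_comp, Fintype.sum_prod_type, Finset.sum_comm, mul_pow,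
    EuclideanSpace.real_norm_sq_eq, ← e.sum_sq_inner_right v, Finset.sum_mul_sum]
  simp [mul_pow, Fin.snocEquiv]

/-- The map `(x, v) ↦ x ⊗ v` from `V^{⊗k} × V` to `V^{⊗(k+1)}`, in the coordinates of the
basis `e`. -/
def tensorMul (e : OrthonormalBasis ι ℝ V) (k : ℕ) :
    EuclideanSpace ℝ (Fin k → ι) →L[ℝ] V →L[ℝ] EuclideanSpace ℝ (Fin (k + 1) → ι) :=
  LinearMap.mkContinuous₂
    (LinearMap.mk₂ ℝ
      (fun x v => WithLp.toLp 2 fun I => x (Fin.init I) * inner ℝ (e (I (Fin.last k))) v)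
      (fun x y v => by ext I; simp [add_mul])
      (fun c x v => by ext I; simp [mul_assoc])
      (fun x v w => by ext I; simp [inner_add_right, mul_add])
      (fun c x v => by ext I; simp [inner_smul_right, mul_left_comm]))
    1 fun x v => by
      refine (sq_le_sq₀ (norm_nonneg _) (by positivity)).1 (le_of_eq ?_)
      rw [one_mul, ← sum_sq_mul_inner e x v, EuclideanSpace.real_norm_sq_eq]
      rfl

omit [FiniteDimensional ℝ V] in
lemma norm_tensorMul_le (e : OrthonormalBasis ι ℝ V) (k : ℕ) : ‖tensorMul e k‖ ≤ 1 :=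
  LinearMap.mkContinuous₂_norm_le _ zero_le_one _

omit [FiniteDimensional ℝ V] in
lemma tensorMul_apply (e : OrthonormalBasis ι ℝ V) {k : ℕ} (x : EuclideanSpace ℝ (Fin k → ι))
    (v : V) (I : Fin (k + 1) → ι) :
    tensorMul e k x v I = x (Fin.init I) * inner ℝ (e (I (Fin.last k))) v :=
  rfl

/-- The level `k` of the signature of `γ` over `[α, t]`, as an element of `V^{⊗k}` with the
Hilbert–Schmidt norm: its coordinates are indexed by the words of length `k` in the basis `e`. -/
def sigLevel (e : OrthonormalBasis ι ℝ V) (γ : BVPath α β V) (k : ℕ) (t : Icc α β) :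
    EuclideanSpace ℝ (Fin k → ι) :=
  WithLp.toLp 2 fun I => γ.sigCoeff k (fun j => innerSL ℝ (e (I j))) t

lemma continuous_sigLevel (e : OrthonormalBasis ι ℝ V) (γ : BVPath α β V) (k : ℕ) :
    Continuous (γ.sigLevel e k) :=
  (PiLp.continuous_toLp 2 _).comp (continuous_pi fun _ => γ.continuous_sigCoeff k _)

lemma sigLevel_succ (e : OrthonormalBasis ι ℝ V) (γ : BVPath α β V) (k : ℕ) (t : Icc α β) :
    γ.sigLevel e (k + 1) t =
      ∫ᵛ u in Iic t, γ.sigLevel e k u ∂[tensorMul e k; γ.stieltjes] := by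
  ext I
  have hint : (γ.stieltjes.restrict (Iic t)).Integrable (γ.sigLevel e k) :=
    VectorMeasure.Integrable.restrict (integrable_of_continuous (γ.continuous_sigLevel e k))
  have hpairing :
      ContinuousLinearMap.toSpanSingleton ℝ (innerSL ℝ (e (I (Fin.last k)))) ∘L
          (EuclideanSpace.proj (Fin.init I) : EuclideanSpace ℝ (Fin k → ι) →L[ℝ] ℝ) =
        (ContinuousLinearMap.compL ℝ V _ ℝ (EuclideanSpace.proj I)) ∘L tensorMul e k := by
    ext x v
    simp [tensorMul_apply]
  calc γ.sigLevel e (k + 1) t I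
      = ∫ᵛ u in Iic t, EuclideanSpace.proj (𝕜 := ℝ) (Fin.init I) (γ.sigLevel e k u)
          ∂[ContinuousLinearMap.toSpanSingleton ℝ (innerSL ℝ (e (I (Fin.last k))));
            γ.stieltjes] := rfl
    _ = EuclideanSpace.proj (𝕜 := ℝ) I
          (∫ᵛ u in Iic t, γ.sigLevel e k u ∂[tensorMul e k; γ.stieltjes]) := by
        rw [VectorMeasure.integral_continuousLinearMap_comp hint,
          VectorMeasure.continuousLinearMap_apply_integral hint, hpairing]

lemma norm_sigLevel_le (e : OrthonormalBasis ι ℝ V) (γ : BVPath α β V) (k : ℕ) (t : Icc α β) :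
    ‖γ.sigLevel e k t‖ ≤ γ.length t ^ k / k.factorial := by
  induction k generalizing t with
  | zero => simp [sigLevel, sigCoeff, EuclideanSpace.norm_eq]
  | succ k ih =>
    calc ‖γ.sigLevel e (k + 1) t‖ ≤ ∫ u in Iic t, ‖γ.sigLevel e k u‖ ∂γ.lengthMeasure := by
          rw [sigLevel_succ]
          exact γ.norm_setIntegral_stieltjes_le (norm_tensorMul_le e k)
            (γ.continuous_sigLevel e k) t
      _ ≤ ∫ u in Iic t, γ.length u ^ k / k.factorial ∂γ.lengthMeasure :=
          setIntegral_mono (integrable_of_continuous (γ.continuous_sigLevel e k)).norm.integrableOn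
            (integrable_of_continuous
              ((γ.continuous_length.pow k).div_const _)).integrableOn ih
      _ = γ.length t ^ (k + 1) / (k + 1).factorial := by
          rw [integral_div, setIntegral_length_pow, div_div, Nat.factorial_succ]
          push_cast
          rfl

lemma abs_sigInner_le (e : OrthonormalBasis ι ℝ V) (γ σ : BVPath α β V) (s t : Icc α β) (k : ℕ) :
    |sigInner e γ σ s t k| ≤ (γ.length s * σ.length t) ^ k / (k.factorial : ℝ) ^ 2 := by
  have hinner : sigInner e γ σ s t k = inner ℝ (γ.sigLevel e k s) (σ.sigLevel e k t) := by
    simp [sigInner, sigLevel, PiLp.inner_apply, mul_comm]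
  calc |sigInner e γ σ s t k| ≤ ‖γ.sigLevel e k s‖ * ‖σ.sigLevel e k t‖ :=
        hinner ▸ abs_real_inner_le_norm _ _
    _ ≤ (γ.length s ^ k / k.factorial) * (σ.length t ^ k / k.factorial) :=
        mul_le_mul (γ.norm_sigLevel_le e k s) (σ.norm_sigLevel_le e k t) (norm_nonneg _)
          (div_nonneg (pow_nonneg (γ.length_nonneg s) _) (Nat.cast_nonneg _))
    _ = (γ.length s * σ.length t) ^ k / (k.factorial : ℝ) ^ 2 := by
        rw [mul_pow, div_mul_div_comm, sq]

end Signature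

end BVPath

namespace GaussQuadrature

open Polynomial Lagrange

section DivisionOfMonomials

lemma sum_range_choose_right (m k : ℕ) : ∑ i ∈ Finset.range k, i.choose m = k.choose (m + 1) := by
  induction k with
  | zero => simp
  | succ k ih => rw [Finset.sum_range_succ, ih, Nat.choose_succ_succ, add_comm]

lemma X_pow_divByMonic_X_sub_C_mul {R : Type*} [CommRing R] {P : R[X]} (hP : P.Monic) (c : R)
    (k : ℕ) :
    X ^ k /ₘ ((X - C c) * P) = ∑ i ∈ Finset.range k, C (c ^ (k - 1 - i)) * (X ^ i /ₘ P) := by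
  nontriviality R
  set r := ∑ i ∈ Finset.range k, C (c ^ (k - 1 - i)) * (X ^ i %ₘ P)
  refine (div_modByMonic_unique _ ((X - C c) * r + C (c ^ k)) ((monic_X_sub_C c).mul hP)
    ⟨?_, ?_⟩).1
  · have hgeom : X ^ k - C c ^ k = (∑ i ∈ Finset.range k, X ^ i * C c ^ (k - 1 - i)) * (X - C c) :=
      ((Commute.all X (C c)).geom_sum₂_mul k).symm
    have hdiv : ∑ i ∈ Finset.range k, X ^ i * C c ^ (k - 1 - i) =
        r + P * ∑ i ∈ Finset.range k, C (c ^ (k - 1 - i)) * (X ^ i /ₘ P) := by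
      simp only [r, Finset.mul_sum, ← Finset.sum_add_distrib]
      refine Finset.sum_congr rfl fun i _ => ?_
      rw [C_pow]
      linear_combination -(C c ^ (k - 1 - i)) * modByMonic_add_div (X ^ i) P
    rw [hdiv] at hgeom
    rw [C_pow]
    linear_combination -hgeom
  · have hr : r.degree < P.degree := by
      refine (degree_sum_le _ _).trans_lt ((Finset.sup_lt_iff ?_).2 fun i _ => ?_)
      · exact bot_lt_iff_ne_bot.2 (degree_ne_bot.2 hP.ne_zero)
      · rw [← smul_eq_C_mul]
        exact (degree_smul_le _ _).trans_lt (degree_modByMonic_lt _ hP)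
    rw [hP.degree_mul, degree_X_sub_C]
    refine (degree_add_le _ _).trans_lt (max_lt ?_ ?_)
    · refine (degree_mul_le _ _).trans_lt ?_
      rw [degree_X_sub_C]
      exact WithBot.add_lt_add_left WithBot.one_ne_bot hr
    · refine degree_C_le.trans_lt ?_
      exact zero_lt_one.trans_le (le_add_of_nonneg_right (zero_le_degree_iff.2 hP.ne_zero))

lemma norm_eval_X_pow_divByMonic_prod_le {𝕜 : Type*} [NormedField 𝕜] {M : ℝ} {x : 𝕜}
    (hx : ‖x‖ ≤ M) {s : Multiset 𝕜} (hs : ∀ c ∈ s, ‖c‖ ≤ M) (k : ℕ) :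
    ‖(X ^ k /ₘ (s.map fun c => X - C c).prod).eval x‖ ≤
      k.choose s.card * M ^ (k - s.card) := by
  have hM : 0 ≤ M := (norm_nonneg x).trans hx
  induction s using Multiset.induction_on generalizing k with
  | empty => simpa using pow_le_pow_left₀ (norm_nonneg x) hx k
  | cons c s ih =>
    have hc : ‖c‖ ≤ M := hs c (Multiset.mem_cons_self c s)
    rw [Multiset.map_cons, Multiset.prod_cons,
      X_pow_divByMonic_X_sub_C_mul (monic_multisetProd_X_sub_C s), eval_finsetSum,
      Multiset.card_cons, ← sum_range_choose_right, Nat.cast_sum, Finset.sum_mul]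
    refine norm_sum_le_of_le _ fun i hi => ?_
    have hi : i < k := Finset.mem_range.1 hi
    calc ‖(C (c ^ (k - 1 - i)) * (X ^ i /ₘ (s.map fun c => X - C c).prod)).eval x‖
        = ‖c‖ ^ (k - 1 - i) * ‖(X ^ i /ₘ (s.map fun c => X - C c).prod).eval x‖ := by
          rw [eval_mul, eval_C, norm_mul, norm_pow]
      _ ≤ M ^ (k - 1 - i) * (i.choose s.card * M ^ (i - s.card)) := by
          gcongr
          exact ih (fun c hc => hs c (Multiset.mem_cons_of_mem hc)) i
      _ = i.choose s.card * M ^ (k - (s.card + 1)) := by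
          rcases lt_or_ge i s.card with h | h
          · simp [Nat.choose_eq_zero_of_lt h]
          · rw [mul_left_comm, ← pow_add]
            congr 2
            omega

end DivisionOfMonomials

section OrthogonalToLowerDegree

variable {F : Type*} [Field F]

/-- `P` is orthogonal to every polynomial of smaller degree for the bilinear form
`(f, g) ↦ φ (f * g)` attached to a linear functional `φ`. -/
def IsOrthogonalPolynomial (φ : F[X] →ₗ[F] F) (P : F[X]) : Prop :=
  ∀ q : F[X], q.degree < P.degree → φ (P * q) = 0

lemma nodal_dvd_of_eval_eq_zero {S : Finset F} {f : F[X]} (hf : ∀ c ∈ S, f.eval c = 0) :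
    nodal S id ∣ f := by
  refine Finset.prod_dvd_of_coprime (fun c _ d _ hne => ?_) fun c hc => dvd_iff_isRoot.2 (hf c hc)
  exact pairwise_coprime_X_sub_C Function.injective_id hne

variable [DecidableEq F]

lemma degree_sub_sum_basis_sq_lt {S : Finset F} {r : F[X]} (hr : r.degree < (2 * S.card : ℕ)) :
    (r - ∑ c ∈ S, r.eval c • Lagrange.basis S id c ^ 2).degree < (2 * S.card : ℕ) := by
  refine (degree_sub_le _ _).trans_lt (max_lt hr ?_)
  refine (degree_sum_le _ _).trans_lt
    ((Finset.sup_lt_iff (WithBot.bot_lt_coe _)).2 fun c hc => ?_)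
  have hpos : 0 < S.card := Finset.card_pos.2 ⟨c, hc⟩
  refine (degree_smul_le _ _).trans_lt ?_
  rw [degree_pow, degree_basis Function.injective_id.injOn hc, nsmul_eq_mul]
  norm_cast
  omega

lemma eval_sub_sum_basis_sq {S : Finset F} (r : F[X]) {c : F} (hc : c ∈ S) :
    (r - ∑ d ∈ S, r.eval d • Lagrange.basis S id d ^ 2).eval c = 0 := by
  have hself : (Lagrange.basis S id c).eval c = 1 :=
    eval_basis_self Function.injective_id.injOn hc
  have hne : ∀ d ∈ S, d ≠ c → (r.eval d • Lagrange.basis S id d ^ 2).eval c = 0 := fun d _ hd => by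
    have h : (Lagrange.basis S id d).eval c = 0 := eval_basis_of_ne (v := id) hd hc
    rw [eval_smul, eval_pow, h, zero_pow two_ne_zero, smul_zero]
  rw [eval_sub, eval_finsetSum, Finset.sum_eq_single_of_mem c hc hne, eval_smul, eval_pow, hself,
    one_pow, smul_eq_mul, mul_one, sub_self]

lemma IsOrthogonalPolynomial.apply_eq_sum_basis_sq {φ : F[X] →ₗ[F] F} {S : Finset F}
    (h : IsOrthogonalPolynomial φ (nodal S id)) {r : F[X]} (hr : r.degree < (2 * S.card : ℕ)) :
    φ r = ∑ c ∈ S, φ (Lagrange.basis S id c ^ 2) * r.eval c := by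
  obtain ⟨q, hq⟩ := nodal_dvd_of_eval_eq_zero fun c hc => eval_sub_sum_basis_sq r hc
  have hdeg := degree_sub_sum_basis_sq_lt hr
  have hqdeg : q.degree < (nodal S id).degree := by
    rw [hq, degree_mul, degree_nodal] at hdeg
    rw [degree_nodal]
    by_contra! hge
    refine hdeg.not_ge ?_
    rw [two_mul, Nat.cast_add]
    gcongr
  have hzero := h q hqdeg
  rw [← hq, map_sub, map_sum, sub_eq_zero] at hzero
  rw [hzero]
  refine Finset.sum_congr rfl fun c _ => ?_
  rw [map_smul, smul_eq_mul, mul_comm]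

end OrthogonalToLowerDegree

section PositiveFunctionals

/-- `φ` is positive definite over `I`: it is strictly positive on every nonzero polynomial which is
nonnegative on `I`. -/
def IsPositiveOn (φ : ℝ[X] →ₗ[ℝ] ℝ) (I : Set ℝ) : Prop :=
  ∀ f : ℝ[X], f ≠ 0 → (∀ x ∈ I, 0 ≤ f.eval x) → 0 < φ f

variable {φ : ℝ[X] →ₗ[ℝ] ℝ} {I : Set ℝ}

lemma IsPositiveOn.apply_nonneg (hφ : IsPositiveOn φ I) {f : ℝ[X]} (hf : ∀ x ∈ I, 0 ≤ f.eval x) :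
    0 ≤ φ f := by
  rcases eq_or_ne f 0 with rfl | hf0
  · rw [map_zero]
  · exact (hφ f hf0 hf).le

lemma IsPositiveOn.abs_apply_le (hφ : IsPositiveOn φ I) {f g : ℝ[X]}
    (h : ∀ x ∈ I, |f.eval x| ≤ g.eval x) : |φ f| ≤ φ g := by
  have hsub := hφ.apply_nonneg (f := g - f) fun x hx => by
    rw [eval_sub]
    linarith [(abs_le.1 (h x hx)).2]
  have hadd := hφ.apply_nonneg (f := g + f) fun x hx => by
    rw [eval_add]
    linarith [(abs_le.1 (h x hx)).1]
  rw [map_sub] at hsub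
  rw [map_add] at hadd
  exact abs_le.2 ⟨by linarith, by linarith⟩

variable {P : ℝ[X]}

lemma IsOrthogonalPolynomial.not_dvd_of_nonneg (hP : IsOrthogonalPolynomial φ P) (hP0 : P ≠ 0)
    (hφ : IsPositiveOn φ I) {d : ℝ[X]} (hd : 0 < d.degree) (hd0 : ∀ x ∈ I, 0 ≤ d.eval x) :
    ¬ d ∣ P := by
  rintro ⟨q, rfl⟩
  have hq0 : q ≠ 0 := right_ne_zero_of_mul hP0
  have hdeg : q.degree < (d * q).degree := by
    rw [degree_mul, degree_eq_natDegree hq0, degree_eq_natDegree (left_ne_zero_of_mul hP0)] at *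
    norm_cast at *
    omega
  refine (hφ (d * q * q) (mul_ne_zero hP0 hq0) fun x hx => ?_).ne' (hP q hdeg)
  rw [mul_assoc, eval_mul, eval_mul]
  exact mul_nonneg (hd0 x hx) (mul_self_nonneg _)

lemma IsOrthogonalPolynomial.not_dvd_of_nonpos (hP : IsOrthogonalPolynomial φ P) (hP0 : P ≠ 0)
    (hφ : IsPositiveOn φ I) {d : ℝ[X]} (hd : 0 < d.degree) (hd0 : ∀ x ∈ I, d.eval x ≤ 0) :
    ¬ d ∣ P := by
  rw [← neg_dvd]
  refine hP.not_dvd_of_nonneg hP0 hφ (by rwa [degree_neg]) fun x hx => ?_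
  rw [eval_neg]
  exact neg_nonneg.2 (hd0 x hx)

lemma eval_nonneg_or_eval_nonpos_of_roots_eq_zero {q : ℝ[X]} (hq : q.roots = 0) :
    (∀ x, 0 ≤ q.eval x) ∨ ∀ x, q.eval x ≤ 0 := by
  rcases eq_or_ne q 0 with rfl | hq0
  · simp
  by_contra! h
  obtain ⟨⟨x, hx⟩, y, hy⟩ := h
  obtain ⟨z, hz⟩ := mem_range_of_exists_le_of_exists_ge q.continuous ⟨x, hx.le⟩ ⟨y, hy.le⟩
  have hroot : z ∈ q.roots := (mem_roots hq0).2 hz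
  rw [hq] at hroot
  exact Multiset.notMem_zero z hroot

lemma IsOrthogonalPolynomial.splits (hP : IsOrthogonalPolynomial φ P) (hP0 : P ≠ 0)
    (hφ : IsPositiveOn φ I) : P.Splits := by
  obtain ⟨q, hq, hcard, hroots⟩ := exists_prod_multiset_X_sub_C_mul P
  have hdvd : q ∣ P := ⟨_, by rw [mul_comm, hq]⟩
  have hconst : ¬ 0 < q.degree := fun hpos =>
    (eval_nonneg_or_eval_nonpos_of_roots_eq_zero hroots).elim
      (fun h => hP.not_dvd_of_nonneg hP0 hφ hpos (fun x _ => h x) hdvd)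
      fun h => hP.not_dvd_of_nonpos hP0 hφ hpos (fun x _ => h x) hdvd
  rw [splits_iff_card_roots, ← hcard, natDegree_eq_zero_iff_degree_le_zero.2 (not_lt.1 hconst),
    add_zero]

lemma IsOrthogonalPolynomial.nodup_roots (hP : IsOrthogonalPolynomial φ P) (hP0 : P ≠ 0)
    (hφ : IsPositiveOn φ I) : P.roots.Nodup := by
  rw [Multiset.nodup_iff_count_le_one]
  intro c
  by_contra! hc
  rw [count_roots] at hc
  refine hP.not_dvd_of_nonneg hP0 hφ ?_ (fun x _ => ?_) ((le_rootMultiplicity_iff hP0).1 hc)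
  · simp
  · rw [eval_pow]
    exact sq_nonneg _

lemma IsOrthogonalPolynomial.roots_subset (hP : IsOrthogonalPolynomial φ P) (hP0 : P ≠ 0)
    (hφ : IsPositiveOn φ I) [hI : I.OrdConnected] {c : ℝ} (hc : c ∈ P.roots) : c ∈ I := by
  have hdvd : X - C c ∣ P := dvd_iff_isRoot.2 (isRoot_of_mem_roots hc)
  have hpos : 0 < (X - C c).degree := by simp
  by_contra hmem
  by_cases hlt : ∃ x ∈ I, x < c
  · obtain ⟨x, hx, hxc⟩ := hlt
    refine hP.not_dvd_of_nonpos hP0 hφ hpos (fun y hy => ?_) hdvd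
    rw [eval_sub, eval_X, eval_C, sub_nonpos]
    by_contra! hcy
    exact hmem (hI.out hx hy ⟨hxc.le, hcy.le⟩)
  · push Not at hlt
    refine hP.not_dvd_of_nonneg hP0 hφ hpos (fun y hy => ?_) hdvd
    rw [eval_sub, eval_X, eval_C, sub_nonneg]
    exact hlt y hy

lemma IsOrthogonalPolynomial.nodal_roots (hP : IsOrthogonalPolynomial φ P) (hP0 : P ≠ 0)
    (hφ : IsPositiveOn φ I) : IsOrthogonalPolynomial φ (nodal P.roots.toFinset id) := by
  have heq : P = P.leadingCoeff • nodal P.roots.toFinset id := by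
    conv_lhs => rw [(hP.splits hP0 hφ).eq_prod_roots]
    rw [smul_eq_C_mul, nodal, Finset.prod, Multiset.toFinset_val, (hP.nodup_roots hP0 hφ).dedup]
    rfl
  have hlc : P.leadingCoeff ≠ 0 := leadingCoeff_ne_zero.2 hP0
  intro q hq
  have h := hP q (by rwa [heq, degree_smul_of_smul_regular _ (IsSMulRegular.of_ne_zero hlc)])
  rw [heq, smul_mul_assoc, map_smul, smul_eq_mul] at h
  exact (mul_eq_zero.1 h).resolve_left hlc

lemma IsOrthogonalPolynomial.abs_quadrature_error_X_pow_le {S : Finset ℝ}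
    (hS : IsOrthogonalPolynomial φ (nodal S id)) (hφ : IsPositiveOn φ I) {M : ℝ}
    (hSM : ∀ c ∈ S, |c| ≤ M) (hIM : ∀ x ∈ I, |x| ≤ M) (k : ℕ) :
    |φ (X ^ k) - ∑ c ∈ S, φ (Lagrange.basis S id c ^ 2) * c ^ k| ≤
      k.choose (2 * S.card) * M ^ (k - 2 * S.card) * φ (nodal S id ^ 2) := by
  set π := nodal S id
  have hmonic : (π ^ 2).Monic := nodal_monic.pow 2
  have hprod : π ^ 2 = ((2 • S.val).map fun c => X - C c).prod := by
    rw [Multiset.map_nsmul, Multiset.prod_nsmul]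
    rfl
  have hdiv : X ^ k = X ^ k %ₘ π ^ 2 + π ^ 2 * (X ^ k /ₘ π ^ 2) := (modByMonic_add_div _ _).symm
  have hexact : φ (X ^ k %ₘ π ^ 2) = ∑ c ∈ S, φ (Lagrange.basis S id c ^ 2) * c ^ k := by
    rw [hS.apply_eq_sum_basis_sq]
    · refine Finset.sum_congr rfl fun c hc => ?_
      have hroot : π.eval c = 0 := eval_nodal_at_node (v := id) hc
      have h := congrArg (eval c) hdiv
      rw [eval_pow, eval_X, eval_add, eval_mul, eval_pow, hroot, zero_pow two_ne_zero, zero_mul,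
        add_zero] at h
      rw [h]
    · refine (degree_modByMonic_lt _ hmonic).trans_eq ?_
      rw [degree_pow, degree_nodal, nsmul_eq_mul]
      norm_cast
  rw [← hexact, sub_eq_of_eq_add' (congrArg φ hdiv |>.trans (map_add φ _ _)),
    ← smul_eq_mul (_ * _), ← map_smul]
  refine hφ.abs_apply_le fun x hx => ?_
  have hquot := norm_eval_X_pow_divByMonic_prod_le (hIM x hx) (s := 2 • S.val)
    (fun c hc => hSM c (Multiset.mem_of_mem_nsmul hc)) k
  rw [← hprod, Multiset.card_nsmul] at hquot
  rw [eval_mul, abs_mul, eval_pow, abs_sq, mul_comm, eval_smul, smul_eq_mul, eval_pow]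
  exact mul_le_mul_of_nonneg_right hquot (sq_nonneg _)

end PositiveFunctionals

section WeightFunctional

variable {a b : ℝ} {w : ℝ → ℝ} {p : ℕ → ℝ[X]}

lemma integrableOn_continuous_mul {f : ℝ → ℝ} (hw : IntegrableOn w (Ioo a b))
    (hf : ContinuousOn f (Icc a b)) : IntegrableOn (fun x => f x * w x) (Ioo a b) :=
  IntegrableOn.continuousOn_mul_of_subset hf hw isCompact_Icc measurableSet_Ioo Ioo_subset_Icc_self

lemma integrableOn_eval_mul (hw : IntegrableOn w (Ioo a b)) (f : ℝ[X]) :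
    IntegrableOn (fun x => f.eval x * w x) (Ioo a b) :=
  integrableOn_continuous_mul hw f.continuous.continuousOn

/-- Integration of polynomials against the weight `w` over `(a, b)`, as a linear functional. -/
def weightFunctional (hw : IntegrableOn w (Ioo a b)) : ℝ[X] →ₗ[ℝ] ℝ where
  toFun f := ∫ x in Ioo a b, f.eval x * w x
  map_add' f g := by
    simp only [eval_add, add_mul]
    exact integral_add (integrableOn_eval_mul hw f) (integrableOn_eval_mul hw g)
  map_smul' c f := by
    simp only [eval_smul, smul_eq_mul, mul_assoc, RingHom.id_apply]
    exact integral_const_mul c _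

lemma weightFunctional_apply (hw : IntegrableOn w (Ioo a b)) (f : ℝ[X]) :
    weightFunctional hw f = ∫ x in Ioo a b, f.eval x * w x := rfl

lemma weightFunctional_X_pow (hw : IntegrableOn w (Ioo a b)) (k : ℕ) :
    weightFunctional hw (X ^ k) = ∫ x in Ioo a b, x ^ k * w x := by
  simp only [weightFunctional_apply, eval_pow, eval_X]

lemma weightFunctional_nodal_sq (hw : IntegrableOn w (Ioo a b)) (n : ℕ) :
    weightFunctional hw (nodal (nodes p n) id ^ 2) =
      ∫ x in Ioo a b, w x * nodePoly p n x ^ 2 := by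
  simp only [weightFunctional_apply, eval_pow, eval_nodal, id, nodePoly, mul_comm]

lemma weightFunctional_basis_sq (hw : IntegrableOn w (Ioo a b)) (n : ℕ) (c : ℝ) :
    weightFunctional hw (Lagrange.basis (nodes p n) id c ^ 2) = weight a b w p n c := by
  simp only [weightFunctional_apply, weight, eval_pow, Lagrange.basis, basisDivisor, eval_prod,
    eval_mul, eval_C, eval_sub, eval_X, id, Finset.prod_pow, div_eq_inv_mul, mul_comm]

lemma isPositiveOn_weightFunctional (hw : IntegrableOn w (Ioo a b))
    (hw_nonneg : 0 ≤ᵐ[volume.restrict (Ioo a b)] w) (hw_ne : ¬ w =ᵐ[volume.restrict (Ioo a b)] 0) :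
    IsPositiveOn (weightFunctional hw) (Ioo a b) := by
  intro f hf0 hf
  have hnonneg : 0 ≤ᵐ[volume.restrict (Ioo a b)] fun x => f.eval x * w x := by
    filter_upwards [hw_nonneg, ae_restrict_mem measurableSet_Ioo] with x hwx hx
    exact mul_nonneg (hf x hx) hwx
  refine (integral_nonneg_of_ae hnonneg).lt_of_ne' fun hzero => hw_ne ?_
  have hae := (integral_eq_zero_iff_of_nonneg_ae hnonneg (integrableOn_eval_mul hw f)).1 hzero
  have hroots : ∀ᵐ x ∂volume.restrict (Ioo a b), f.eval x ≠ 0 :=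
    ae_restrict_of_ae (compl_mem_ae_iff.2 ((finite_setOfPred_isRoot hf0).measure_zero volume))
  filter_upwards [hae, hroots] with x hx hfx
  exact (mul_eq_zero.1 hx).resolve_left hfx

lemma exists_degree_sub_smul_lt {F : Type*} [Field F] {P : F[X]} {m : ℕ} (hP : P.degree = m)
    {q : F[X]} (hq : q.degree < (m + 1 : ℕ)) : ∃ c : F, (q - c • P).degree < m := by
  have hlc : P.coeff m ≠ 0 := coeff_ne_zero_of_eq_degree hP
  refine ⟨q.coeff m / P.coeff m, (degree_lt_iff_coeff_zero _ _).2 fun k hk => ?_⟩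
  rw [coeff_sub, coeff_smul, smul_eq_mul, sub_eq_zero]
  rcases hk.eq_or_lt with rfl | hlt
  · rw [div_mul_cancel₀ _ hlc]
  · have hPk : P.degree < k := hP.trans_lt (by exact_mod_cast hlt)
    rw [coeff_eq_zero_of_degree_lt hPk, mul_zero,
      coeff_eq_zero_of_degree_lt (hq.trans_le (by exact_mod_cast hlt))]

lemma IsOrthogonalSystem.isOrthogonalPolynomial (hp : IsOrthogonalSystem a b w p)
    (hw : IntegrableOn w (Ioo a b)) (N : ℕ) :
    IsOrthogonalPolynomial (weightFunctional hw) (p N) := by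
  have horth : ∀ m ≠ N, weightFunctional hw (p N * p m) = 0 := fun m hm => by
    simpa only [weightFunctional_apply, eval_mul] using hp.orthogonal N m hm.symm
  suffices h : ∀ m ≤ N, ∀ q : ℝ[X], q.degree < m → weightFunctional hw (p N * q) = 0 from
    fun q hq => h N le_rfl q (hp.degree_eq N ▸ hq)
  intro m hm
  induction m with
  | zero =>
    intro q hq
    rw [show q = 0 by simpa using hq, mul_zero, map_zero]
  | succ m ih =>
    intro q hq
    obtain ⟨c, hc⟩ := exists_degree_sub_smul_lt (hp.degree_eq m) hq
    have h := ih (Nat.le_of_succ_le hm) _ hc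
    rwa [mul_sub, map_sub, mul_smul_comm, map_smul, horth m (by omega), smul_zero, sub_zero] at h

lemma IsOrthogonalSystem.ne_zero (hp : IsOrthogonalSystem a b w p) (N : ℕ) : p N ≠ 0 :=
  degree_ne_bot.1 (by rw [hp.degree_eq]; exact WithBot.natCast_ne_bot N)

variable (hp : IsOrthogonalSystem a b w p) (hw : IntegrableOn w (Ioo a b))
  (hw_nonneg : 0 ≤ᵐ[volume.restrict (Ioo a b)] w) (hw_ne : ¬ w =ᵐ[volume.restrict (Ioo a b)] 0)

include hp hw hw_nonneg hw_ne

lemma IsOrthogonalSystem.card_nodes (n : ℕ) : (nodes p n).card = n + 1 := by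
  have horth := hp.isOrthogonalPolynomial hw (n + 1)
  have hpos := isPositiveOn_weightFunctional hw hw_nonneg hw_ne
  rw [nodes, Multiset.toFinset_card_of_nodup (horth.nodup_roots (hp.ne_zero _) hpos),
    splits_iff_card_roots.1 (horth.splits (hp.ne_zero _) hpos),
    natDegree_eq_of_degree_eq_some (hp.degree_eq _)]

lemma IsOrthogonalSystem.abs_quadrature_error_pow_le (n k : ℕ) :
    |(∫ x in Ioo a b, x ^ k * w x) - ∑ c ∈ nodes p n, weight a b w p n c * c ^ k| ≤
      k.choose (2 * n + 2) * max |a| |b| ^ (k - (2 * n + 2)) *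
        ∫ x in Ioo a b, w x * nodePoly p n x ^ 2 := by
  have horth := hp.isOrthogonalPolynomial hw (n + 1)
  have hpos := isPositiveOn_weightFunctional hw hw_nonneg hw_ne
  have hbound : ∀ x ∈ Ioo a b, |x| ≤ max |a| |b| := fun x hx => abs_le_max_abs_abs hx.1.le hx.2.le
  have hnodes : ∀ c ∈ nodes p n, |c| ≤ max |a| |b| := fun c hc =>
    hbound c (horth.roots_subset (hp.ne_zero _) hpos (Multiset.mem_toFinset.1 hc))
  have hnodal : IsOrthogonalPolynomial (weightFunctional hw) (nodal (nodes p n) id) :=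
    horth.nodal_roots (hp.ne_zero _) hpos
  have h := hnodal.abs_quadrature_error_X_pow_le hpos hnodes hbound k
  rwa [weightFunctional_X_pow, weightFunctional_nodal_sq,
    hp.card_nodes hw hw_nonneg hw_ne, mul_add_one,
    Finset.sum_congr rfl fun c _ => by rw [weightFunctional_basis_sq]] at h

end WeightFunctional

section PowerSeries

variable {A : ℕ → ℝ} {Λ : ℝ}

lemma norm_pow_mul_coeff_le (hA : ∀ k, |A k| ≤ Λ ^ k / (k.factorial : ℝ) ^ 2) (hΛ : 0 ≤ Λ)
    {M x : ℝ} (hx : |x| ≤ M) (k : ℕ) : ‖x ^ k * A k‖ ≤ (M * Λ) ^ k / k.factorial := by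
  have hk : (k.factorial : ℝ) ≤ (k.factorial : ℝ) ^ 2 :=
    le_self_pow₀ (by exact_mod_cast k.factorial_pos) two_ne_zero
  have hM : 0 ≤ M := (abs_nonneg x).trans hx
  calc ‖x ^ k * A k‖ = |x| ^ k * |A k| := by simp only [norm_mul, norm_pow, Real.norm_eq_abs]
    _ ≤ M ^ k * (Λ ^ k / (k.factorial : ℝ) ^ 2) := by
      gcongr
      exact hA k
    _ ≤ M ^ k * (Λ ^ k / k.factorial) := by gcongr
    _ = (M * Λ) ^ k / k.factorial := by rw [mul_pow, mul_div_assoc]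

lemma summable_pow_mul_coeff (hA : ∀ k, |A k| ≤ Λ ^ k / (k.factorial : ℝ) ^ 2) (hΛ : 0 ≤ Λ)
    (x : ℝ) : Summable fun k => x ^ k * A k :=
  .of_norm_bounded (Real.summable_pow_div_factorial (|x| * Λ))
    (norm_pow_mul_coeff_le hA hΛ le_rfl)

variable {a b : ℝ} {w : ℝ → ℝ}

lemma integrableOn_tsum_mul (hA : ∀ k, |A k| ≤ Λ ^ k / (k.factorial : ℝ) ^ 2) (hΛ : 0 ≤ Λ)
    (hw : IntegrableOn w (Ioo a b)) :
    IntegrableOn (fun x => (∑' k, x ^ k * A k) * w x) (Ioo a b) :=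
  integrableOn_continuous_mul hw <| continuousOn_tsum
    (fun k => ((continuous_pow k).mul_const (A k)).continuousOn)
    (Real.summable_pow_div_factorial (max |a| |b| * Λ))
    fun k _ hx => norm_pow_mul_coeff_le hA hΛ (abs_le_max_abs_abs hx.1 hx.2) k

lemma hasSum_integral_pow_mul (hA : ∀ k, |A k| ≤ Λ ^ k / (k.factorial : ℝ) ^ 2) (hΛ : 0 ≤ Λ)
    (hw : IntegrableOn w (Ioo a b)) :
    HasSum (fun k => A k * ∫ x in Ioo a b, x ^ k * w x)
      (∫ x in Ioo a b, (∑' k, x ^ k * A k) * w x) := by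
  have hs := Real.summable_pow_div_factorial (max |a| |b| * Λ)
  simp_rw [← integral_const_mul]
  refine hasSum_integral_of_dominated_convergence
    (fun k x => (max |a| |b| * Λ) ^ k / k.factorial * ‖w x‖) (fun k => ?_) (fun k => ?_)
    (.of_forall fun x => hs.mul_right _) ?_ (.of_forall fun x => ?_)
  · exact (integrableOn_continuous_mul hw
      (continuous_pow k).continuousOn).aestronglyMeasurable.const_mul (A k)
  · filter_upwards [ae_restrict_mem measurableSet_Ioo] with x hx
    rw [← mul_assoc, mul_comm (A k), norm_mul]
    gcongr
    exact norm_pow_mul_coeff_le hA hΛ (abs_le_max_abs_abs hx.1.le hx.2.le) k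
  · simp_rw [tsum_mul_right]
    exact hw.norm.const_mul _
  · refine ((summable_pow_mul_coeff hA hΛ x).hasSum.mul_right (w x)).congr_fun fun k => ?_
    rw [← mul_assoc, mul_comm (A k)]

lemma hasSum_mul_quadrature_error (hA : ∀ k, |A k| ≤ Λ ^ k / (k.factorial : ℝ) ^ 2) (hΛ : 0 ≤ Λ)
    (hw : IntegrableOn w (Ioo a b)) (S : Finset ℝ) (u : ℝ → ℝ) :
    HasSum (fun k => A k * ((∫ x in Ioo a b, x ^ k * w x) - ∑ c ∈ S, u c * c ^ k))
      ((∫ x in Ioo a b, (∑' k, x ^ k * A k) * w x) - ∑ c ∈ S, u c * ∑' k, c ^ k * A k) := by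
  have hnodes : HasSum (fun k => ∑ c ∈ S, u c * (c ^ k * A k))
      (∑ c ∈ S, u c * ∑' k, c ^ k * A k) :=
    hasSum_sum fun c _ => (summable_pow_mul_coeff hA hΛ c).hasSum.mul_left _
  refine ((hasSum_integral_pow_mul hA hΛ hw).sub hnodes).congr_fun fun k => ?_
  rw [mul_sub, Finset.mul_sum]
  congr 1
  exact Finset.sum_congr rfl fun c _ => by ring

lemma choose_mul_factorial_le {m : ℕ} (hm : 0 < m) (j : ℕ) :
    (j + m).choose m * (m.factorial ^ 2 * j.factorial * 2 ^ j) ≤ (j + m).factorial ^ 2 := by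
  have hpow : m.factorial * 2 ^ j ≤ (j + m).factorial := by
    rw [add_comm j]
    refine le_trans ?_ Nat.factorial_mul_pow_le_factorial
    gcongr
    omega
  calc (j + m).choose m * (m.factorial ^ 2 * j.factorial * 2 ^ j)
      = (j + m).choose m * j.factorial * m.factorial * (m.factorial * 2 ^ j) := by ring
    _ = (j + m).factorial * (m.factorial * 2 ^ j) := by
      rw [Nat.add_choose_mul_factorial_mul_factorial]
    _ ≤ (j + m).factorial ^ 2 := by
      rw [sq]
      gcongr

lemma coeff_bound_mul_choose_le {M : ℝ} (hM : 0 ≤ M) (hΛ : 0 ≤ Λ) {m : ℕ} (hm : 0 < m) (j : ℕ) :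
    Λ ^ (j + m) / ((j + m).factorial : ℝ) ^ 2 * ((j + m).choose m * M ^ j) ≤
      Λ ^ m / (m.factorial : ℝ) ^ 2 * ((M / 2 * Λ) ^ j / j.factorial) := by
  have hfac : ((j + m).choose m : ℝ) * ((m.factorial : ℝ) ^ 2 * j.factorial * 2 ^ j) ≤
      ((j + m).factorial : ℝ) ^ 2 := by
    exact_mod_cast choose_mul_factorial_le hm j
  calc Λ ^ (j + m) / ((j + m).factorial : ℝ) ^ 2 * ((j + m).choose m * M ^ j)
      = Λ ^ (j + m) * M ^ j * ((j + m).choose m / ((j + m).factorial : ℝ) ^ 2) := by ring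
    _ ≤ Λ ^ (j + m) * M ^ j * (1 / ((m.factorial : ℝ) ^ 2 * j.factorial * 2 ^ j)) := by
      refine mul_le_mul_of_nonneg_left ?_ (by positivity)
      rwa [div_le_div_iff₀ (by positivity) (by positivity), one_mul]
    _ = Λ ^ m / (m.factorial : ℝ) ^ 2 * ((M / 2 * Λ) ^ j / j.factorial) := by
      rw [mul_pow, div_pow, pow_add]
      field_simp

lemma abs_le_of_hasSum_mul_of_abs_le_choose {E : ℕ → ℝ} {T M W : ℝ} {m : ℕ}
    (hA : ∀ k, |A k| ≤ Λ ^ k / (k.factorial : ℝ) ^ 2) (hΛ : 0 ≤ Λ) (hM : 0 ≤ M) (hW : 0 ≤ W)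
    (hm : 0 < m) (hE : ∀ k, |E k| ≤ k.choose m * M ^ (k - m) * W)
    (hT : HasSum (fun k => A k * E k) T) :
    |T| ≤ Λ ^ m / (m.factorial : ℝ) ^ 2 * W * Real.exp (M / 2 * Λ) := by
  have hzero : ∑ k ∈ Finset.range m, A k * E k = 0 := by
    refine Finset.sum_eq_zero fun k hk => ?_
    have h := hE k
    rw [Nat.choose_eq_zero_of_lt (Finset.mem_range.1 hk), Nat.cast_zero, zero_mul, zero_mul,
      abs_nonpos_iff] at h
    rw [h, mul_zero]
  have htail := (hasSum_nat_add_iff' m).2 hT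
  rw [hzero, sub_zero] at htail
  have hexp := (NormedSpace.expSeries_div_hasSum_exp (M / 2 * Λ)).mul_left
    (Λ ^ m / (m.factorial : ℝ) ^ 2 * W)
  rw [← Real.exp_eq_exp_ℝ] at hexp
  refine htail.norm_le_of_bounded hexp fun j => ?_
  calc ‖A (j + m) * E (j + m)‖
      ≤ Λ ^ (j + m) / ((j + m).factorial : ℝ) ^ 2 * ((j + m).choose m * M ^ j * W) := by
        rw [norm_mul]
        have h := hE (j + m)
        rw [Nat.add_sub_cancel] at h
        exact mul_le_mul (hA _) h (abs_nonneg _) (by positivity)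
    _ = Λ ^ (j + m) / ((j + m).factorial : ℝ) ^ 2 * ((j + m).choose m * M ^ j) * W := by ring
    _ ≤ Λ ^ m / (m.factorial : ℝ) ^ 2 * ((M / 2 * Λ) ^ j / j.factorial) * W :=
        mul_le_mul_of_nonneg_right (coeff_bound_mul_choose_le hM hΛ hm j) hW
    _ = Λ ^ m / (m.factorial : ℝ) ^ 2 * W * ((M / 2 * Λ) ^ j / j.factorial) := by ring

end PowerSeries

lemma exists_mem_Ioo_half_le_abs {a b : ℝ} (hab : a < b) :
    ∃ ξ ∈ Ioo a b, max |a| |b| / 2 ≤ |ξ| := by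
  by_contra! h
  have hIcc : Icc a b ⊆ {x | |x| ≤ max |a| |b| / 2} := by
    rw [← closure_Ioo hab.ne]
    exact closure_minimal (fun x hx => (h x hx).le)
      (isClosed_le continuous_abs continuous_const)
  have hmax : max |a| |b| ≤ max |a| |b| / 2 :=
    max_le (hIcc (left_mem_Icc.2 hab.le)) (hIcc (right_mem_Icc.2 hab.le))
  have ha := (neg_abs_le a).trans' (neg_le_neg (le_max_left |a| |b|))
  have hb := (le_abs_self b).trans (le_max_right |a| |b|)
  linarith

section QuadratureError

variable {a b : ℝ} {w : ℝ → ℝ}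

lemma IsOrthogonalSystem.abs_quadrature_error_tsum_le {p : ℕ → ℝ[X]}
    (hp : IsOrthogonalSystem a b w p) (hw : IntegrableOn w (Ioo a b))
    (hw_nonneg : 0 ≤ᵐ[volume.restrict (Ioo a b)] w) (hw_ne : ¬ w =ᵐ[volume.restrict (Ioo a b)] 0)
    {A : ℕ → ℝ} {Λ : ℝ} (hA : ∀ k, |A k| ≤ Λ ^ k / (k.factorial : ℝ) ^ 2) (hΛ : 0 ≤ Λ) (n : ℕ) :
    ∃ ξ ∈ Ioo a b,
      |(∫ x in Ioo a b, (∑' k, x ^ k * A k) * w x) -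
          ∑ c ∈ nodes p n, weight a b w p n c * ∑' k, c ^ k * A k| ≤
        Λ ^ (2 * n + 2) * Real.exp (|ξ| * Λ) / ((2 * n + 2).factorial : ℝ) ^ 2 *
          ∫ x in Ioo a b, w x * nodePoly p n x ^ 2 := by
  have hab : a < b := by
    by_contra hba
    exact hw_ne (by simp [Ioo_eq_empty hba, EventuallyEq])
  obtain ⟨ξ, hξ, hMξ⟩ := exists_mem_Ioo_half_le_abs hab
  refine ⟨ξ, hξ, ?_⟩
  have hW : 0 ≤ ∫ x in Ioo a b, w x * nodePoly p n x ^ 2 :=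
    integral_nonneg_of_ae (hw_nonneg.mono fun x hx => mul_nonneg hx (sq_nonneg _))
  have hsum := hasSum_mul_quadrature_error hA hΛ hw (nodes p n) (weight a b w p n)
  calc _ ≤ Λ ^ (2 * n + 2) / ((2 * n + 2).factorial : ℝ) ^ 2 *
          (∫ x in Ioo a b, w x * nodePoly p n x ^ 2) * Real.exp (max |a| |b| / 2 * Λ) :=
        abs_le_of_hasSum_mul_of_abs_le_choose hA hΛ (by positivity) hW (by positivity)
          (hp.abs_quadrature_error_pow_le hw hw_nonneg hw_ne n) hsum
    _ ≤ Λ ^ (2 * n + 2) / ((2 * n + 2).factorial : ℝ) ^ 2 *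
          (∫ x in Ioo a b, w x * nodePoly p n x ^ 2) * Real.exp (|ξ| * Λ) := by gcongr
    _ = _ := by ring

lemma ae_nonneg_of_forall_pos (hw : ∀ x ∈ Ioo a b, 0 < w x) :
    0 ≤ᵐ[volume.restrict (Ioo a b)] w := by
  filter_upwards [ae_restrict_mem measurableSet_Ioo] with x hx
  exact (hw x hx).le

lemma not_ae_eq_zero_of_forall_pos (hab : a < b) (hw : ∀ x ∈ Ioo a b, 0 < w x) :
    ¬ w =ᵐ[volume.restrict (Ioo a b)] 0 := by
  intro hzero
  have hnull : ∀ᵐ _ ∂volume.restrict (Ioo a b), False := by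
    filter_upwards [hzero, ae_restrict_mem measurableSet_Ioo] with x hx hmem
    exact (hw x hmem).ne' hx
  rw [eventually_false_iff_eq_bot, ae_eq_bot, Measure.restrict_eq_zero, Real.volume_Ioo,
    ENNReal.ofReal_eq_zero, sub_nonpos] at hnull
  exact hnull.not_gt hab

end QuadratureError

end GaussQuadrature

end

theorem proposition4p2_general
    {V : Type*} [NormedAddCommGroup V] [InnerProductSpace ℝ V] [FiniteDimensional ℝ V]
    {ι : Type*} [Fintype ι] (e : OrthonormalBasis ι ℝ V)
    {α β : ℝ} (γ σ : BVPath α β V) (s t : Set.Icc α β)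
    {a b : ℝ} (w : ℝ → ℝ) (hw_int : IntegrableOn w (Set.Ioo a b))
    (hw_nonneg : 0 ≤ᵐ[volume.restrict (Set.Ioo a b)] w)
    (hw_ne : ¬ w =ᵐ[volume.restrict (Set.Ioo a b)] 0)
    (p : ℕ → Polynomial ℝ) (hp : GaussQuadrature.IsOrthogonalSystem a b w p) (n : ℕ) :
    (∀ x : ℝ, Summable (BVPath.sigInner e (γ.scale x) σ s t)) ∧
    IntegrableOn (fun x => BVPath.sigKernel e (γ.scale x) σ s t * w x) (Set.Ioo a b) ∧
    (GaussQuadrature.nodes p n).card = n + 1 ∧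
    ∃ ξ ∈ Set.Ioo a b,
      |(∫ x in Set.Ioo a b, BVPath.sigKernel e (γ.scale x) σ s t * w x) -
          ∑ c ∈ GaussQuadrature.nodes p n,
            GaussQuadrature.weight a b w p n c * BVPath.sigKernel e (γ.scale c) σ s t| ≤
        γ.length s ^ (2 * n + 2) * σ.length t ^ (2 * n + 2) *
            Real.exp (|ξ| * (γ.length s * σ.length t)) /
          ((2 * n + 2).factorial : ℝ) ^ 2 *
          ∫ x in Set.Ioo a b, w x * GaussQuadrature.nodePoly p n x ^ 2 := by
  have hcoeff := BVPath.abs_sigInner_le e γ σ s t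
  have hlength : 0 ≤ γ.length s * σ.length t :=
    mul_nonneg (γ.length_nonneg s) (σ.length_nonneg t)
  have hkernel : ∀ x, BVPath.sigKernel e (γ.scale x) σ s t =
      ∑' k, x ^ k * BVPath.sigInner e γ σ s t k := fun x =>
    tsum_congr (BVPath.sigInner_scale e x γ σ s t)
  simp_rw [hkernel, ← mul_pow]
  refine ⟨fun x => ?_, GaussQuadrature.integrableOn_tsum_mul hcoeff hlength hw_int,
    hp.card_nodes hw_int hw_nonneg hw_ne n,
    hp.abs_quadrature_error_tsum_le hw_int hw_nonneg hw_ne hcoeff hlength n⟩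
  exact (GaussQuadrature.summable_pow_mul_coeff hcoeff hlength x).congr fun k =>
    (BVPath.sigInner_scale e x γ σ s t k).symm

theorem proposition4p2
    {V : Type*} [NormedAddCommGroup V] [InnerProductSpace ℝ V] [FiniteDimensional ℝ V]
    {ι : Type*} [Fintype ι] (e : OrthonormalBasis ι ℝ V)
    {α β : ℝ} (γ σ : BVPath α β V) (s t : Set.Icc α β)
    {a b : ℝ} (hab : a < b)
    (w : ℝ → ℝ) (hw_cont : ContinuousOn w (Set.Ioo a b))
    (hw_pos : ∀ x ∈ Set.Ioo a b, 0 < w x)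
    (hw_int : IntegrableOn w (Set.Ioo a b))
    (p : ℕ → Polynomial ℝ) (hp : GaussQuadrature.IsOrthogonalSystem a b w p) (n : ℕ) :
    -- the kernel series converges, the integral exists, and there are `n + 1` nodes
    (∀ x : ℝ, Summable (BVPath.sigInner e (γ.scale x) σ s t)) ∧
    IntegrableOn (fun x => BVPath.sigKernel e (γ.scale x) σ s t * w x) (Set.Ioo a b) ∧
    (GaussQuadrature.nodes p n).card = n + 1 ∧
    -- the error bound
    ∃ ξ ∈ Set.Ioo a b,
      |(∫ x in Set.Ioo a b, BVPath.sigKernel e (γ.scale x) σ s t * w x) -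
          ∑ c ∈ GaussQuadrature.nodes p n,
            GaussQuadrature.weight a b w p n c * BVPath.sigKernel e (γ.scale c) σ s t| ≤
        γ.length s ^ (2 * n + 2) * σ.length t ^ (2 * n + 2) *
            Real.exp (|ξ| * (γ.length s * σ.length t)) /
          ((2 * n + 2).factorial : ℝ) ^ 2 *
          ∫ x in Set.Ioo a b, w x * GaussQuadrature.nodePoly p n x ^ 2 :=
  proposition4p2_general e γ σ s t w hw_int (GaussQuadrature.ae_nonneg_of_forall_pos hw_pos)
    (GaussQuadrature.not_ae_eq_zero_of_forall_pos hab hw_pos) p hp n
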